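/- **Setting.** Consider a POMDP with measurable state, action and observation spaces $X,A,\mathcal Z$ (no finiteness assumed), transition kernel $\mathcal T(\cdot\mid x,a)$, observation density $Z(z\mid a,x')$ with respect to a fixed reference measure, measurable cost $c:X\times A\to[R_{\min},R_{\max}]$ and discount $\gamma\in[0,1]$. For $N_p\in\mathbb N$ let $\Sigma$ be the set of particle beliefs $\bar b=\{(x_i,w_i)\}_{i=1}^{N_p}$ with $x_i\in X$, $w_i\ge 0$ and some $w_i>0$. The particle-belief MDP $M_P=(\Sigma,A,\tau,\rho,\gamma)$ has cost $\rho(\bar b,a)=\sum_i w_i c(x_i,a)/\sum_i w_i$, and $\tau(\cdot\mid\bar b,a)$ is the law of the particle-filter step $\mathrm{GenPF}(\bar b,a)$: draw $x_0$ from $\bar b$ ($x_i$ with probability $w_i/\sum_j w_j$), $x_0'\sim\mathcal T(\cdot\mid x_0,a)$ and $z\sim Z(\cdot\mid a,x_0')$; independently draw $x_i'\sim\mathcal T(\cdot\mid x_i,a)$ for $i=1,\dots,N_p$; return $\{(x_i',\,w_i Z(z\mid a,x_i'))\}_{i=1}^{N_p}$. It is assumed that for all $\bar b\in\Sigma$,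 $a\in A$ this lies in $\Sigma$ almost surely (so that $\tau$ is a transition probability on $\Sigma$). Let $\alpha\in(0,1]$. For an integrable random variable $Y$ put $\mathrm{CVaR}_\alpha(Y)=\inf_{w\in\mathbb R}\{w+\frac1\alpha\mathbb E[(Y-w)^+]\}$, and for real numbers $y_1,\dots,y_n$ put $\hat C_\alpha(y_1,\dots,y_n)=\inf_{w\in\mathbb R}\{w+\frac1{n\alpha}\sum_{i=1}^n(y_i-w)^+\}$. For a horizon $T$ and a measurable policy $\pi=(\pi_t)$, $\pi_t:\Sigma\to A$, the ICVaR value functions are $V^\pi_{M_P,t}(\cdot,\alpha)=0$ for $t>T$ and, for $t\le T$, $$Q^\pi_{M_P,t}(\bar b,a,\alpha)=\rho(\bar b,a)+\gamma\,\mathrm{CVaR}_\alpha\big[V^\pi_{M_P,t+1}(\bar b',\alpha)\big],\ \ \bar b'\sim\tau(\cdot\mid\bar b,a),\qquad V^\pi_{M_P,t}(\bar b,\alpha)=Q^\pi_{M_P,t}(\bar b,\pi_t(\bar b),\alpha).$$ The recursive sampling estimator with branching factor $N_b$ is $\hat V^\pi_{M_P,t}=0$ for $t>T$ and, for $t\le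 T$, $$\hat Q^\pi_{M_P,t}(\bar b,a,\alpha)=\rho(\bar b,a)+\gamma\,\hat C_\alpha\big(\{\hat V^\pi_{M_P,t+1}(\bar b'_i,\alpha)\}_{i=1}^{N_b}\big),\qquad \hat V^\pi_{M_P,t}(\bar b,\alpha)=\hat Q^\pi_{M_P,t}(\bar b,\pi_t(\bar b),\alpha),$$ where $\bar b'_1,\dots,\bar b'_{N_b}$ are i.i.d. from $\tau(\cdot\mid\bar b,a)$ and each recursive call uses fresh independent randomness. **Theorem.** Let $\delta\in(0,1)$, $0\le t\le T$, $\bar b_t\in\Sigma$, $a\in A$, and $$\Delta R=R_{\max}-R_{\min},\qquad T_{\alpha,t}=\sum_{k=0}^{T-t-1}\frac{T-t-k}{\alpha^k},\qquad T'_{\alpha,t}=\sum_{j=0}^{T-t-1}\frac{T-t+1-j}{\alpha^j}.$$ If $N_b>1$, then $$P\Bigg(Q^\pi_{M_P,t}(\bar b_t,a,\alpha)-\hat Q^\pi_{M_P,t}(\bar b_t,a,\alpha)\le\gamma\,\Delta R\;T_{\alpha,t}\sqrt{\frac{5\ln\frac{3(N_b^{T-t}-1)}{\delta(N_b-1)}}{\alpha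 N_b}}\Bigg)\ge 1-\delta,$$ $$P\Bigg(Q^\pi_{M_P,t}(\bar b_t,a,\alpha)-\hat Q^\pi_{M_P,t}(\bar b_t,a,\alpha)\ge-\frac{\gamma\,\Delta R}{\alpha}\sqrt{\frac{\ln\frac{N_b^{T-t}-1}{\delta(N_b-1)}}{2N_b}}\;T'_{\alpha,t}\Bigg)\ge 1-\delta.$$ If $N_b=1$, then $$P\Bigg(Q^\pi_{M_P,t}(\bar b_t,a,\alpha)-\hat Q^\pi_{M_P,t}(\bar b_t,a,\alpha)\le\gamma\,\Delta R\sqrt{\frac{5\ln\frac{3(T-t)}{\delta}}{\alpha}}\;T_{\alpha,t}\Bigg)\ge 1-\delta,$$ $$P\Bigg(Q^\pi_{M_P,t}(\bar b_t,a,\alpha)-\hat Q^\pi_{M_P,t}(\bar b_t,a,\alpha)\ge-\frac{\gamma\,\Delta R}{\alpha}\sqrt{\frac{\ln\frac{T-t}{\delta}}{2}}\;T'_{\alpha,t}\Bigg)\ge 1-\delta.$$ For $t=T$, where both sums are empty, all bounds are read as $0$. The bounds do not depend on the cardinality of $A$. -/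

import Mathlib

open MeasureTheory ProbabilityTheory
open scoped NNReal ENNReal

noncomputable section

/-! ### Conditional value at risk -/

/-- `CVaR_α(Y) = inf_w { w + α⁻¹ 𝔼[(Y - w)⁺] }` for a random variable `Y` under the law `μ`. -/
def cvar {Ω : Type*} [MeasurableSpace Ω] (α : ℝ) (μ : Measure Ω) (Y : Ω → ℝ) : ℝ :=
  ⨅ w : ℝ, (w + 1 / α * ∫ ω, max (Y ω - w) 0 ∂μ)

/-- The empirical estimator `Ĉ_α(y₁, …, yₙ) = inf_w { w + (nα)⁻¹ ∑ᵢ (yᵢ - w)⁺ }`. -/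
def empCVaR {n : ℕ} (α : ℝ) (y : Fin n → ℝ) : ℝ :=
  ⨅ w : ℝ, (w + 1 / ((n : ℝ) * α) * ∑ i, max (y i - w) 0)

theorem measurable_empCVaR {n : ℕ} (α : ℝ) :
    Measurable (empCVaR α : (Fin n → ℝ) → ℝ) := by
  have h : (empCVaR α : (Fin n → ℝ) → ℝ) = fun y => ⨅ q : ℚ,
      ((q : ℝ) + 1 / ((n : ℝ) * α) * ∑ i, max (y i - (q : ℝ)) 0) := by
    funext y
    have hc : Continuous fun w : ℝ => w + 1 / ((n : ℝ) * α) * ∑ i, max (y i - w) 0 := by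
      fun_prop
    have hd := Dense.ciInf' (S := Set.range ((↑) : ℚ → ℝ)) Rat.denseRange_cast hc
    rw [empCVaR, ← hd]
    simp only [iInf, Set.range]
    congr 1
    ext r
    simp
  rw [h]
  refine Measurable.iInf fun q => ?_
  fun_prop

/-! ### Product kernels -/

/-- Independent draws from the Markov kernels `κ i`, all started at the same point. -/
def piKernel {α β ι : Type*} [MeasurableSpace α] [MeasurableSpace β] [Fintype ι]
    (κ : ι → Kernel α β) [∀ i, IsMarkovKernel (κ i)] : Kernel α (ι → β) where
  toFun x := Measure.pi fun i => κ i x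
  measurable' := by
    refine Measurable.measure_of_isPiSystem_of_isProbabilityMeasure
      generateFrom_pi.symm isPiSystem_pi ?_
    rintro _ ⟨s, hs, rfl⟩
    simp only [Set.mem_pi, Set.mem_univ, forall_const, Set.mem_ofPred_eq] at hs
    simp only [Measure.pi_pi]
    exact Finset.measurable_prod _ fun i _ => Kernel.measurable_coe _ (hs i)

instance piKernel.isMarkovKernel {α β ι : Type*} [MeasurableSpace α] [MeasurableSpace β]
    [Fintype ι] (κ : ι → Kernel α β) [∀ i, IsMarkovKernel (κ i)] :
    IsMarkovKernel (piKernel κ) :=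
  ⟨fun x => inferInstanceAs (IsProbabilityMeasure (Measure.pi fun i => κ i x))⟩

/-! ### Markov decision processes with costs, and iterated CVaR -/

/-- A Markov decision process `(S, A, τ, ρ, γ)` with costs. -/
structure CostMDP (S A : Type*) [MeasurableSpace S] [MeasurableSpace A] where
  trans : Kernel (S × A) S
  trans_markov : IsMarkovKernel trans
  cost : S × A → ℝ
  measurable_cost : Measurable cost
  discount : ℝ

/-- A (deterministic, time-dependent) policy: at time `t` the action `π t s` is taken in `s`. -/
abbrev Policy (S A : Type*) [MeasurableSpace S] [MeasurableSpace A] : Type _ :=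
  ℕ → {f : S → A // Measurable f}

namespace CostMDP

variable {S A : Type*} [MeasurableSpace S] [MeasurableSpace A]

instance (M : CostMDP S A) : IsMarkovKernel M.trans := M.trans_markov

/-- The ICVaR value function `V^π_t(·, α)` for the horizon `T`: zero for `t > T`, and
`V^π_t(s, α) = Q^π_t(s, π_t(s), α)` for `t ≤ T` (see `icvarV_eq`). -/
def icvarV (M : CostMDP S A) (π : Policy S A) (α : ℝ) (T t : ℕ) (s : S) : ℝ :=
  if T < t then 0
  else M.cost (s, (π t).1 s) +
    M.discount * cvar α (M.trans (s, (π t).1 s)) (fun s' => icvarV M π α T (t + 1) s')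
  termination_by T + 1 - t

/-- The ICVaR action-value function
`Q^π_t(s, a, α) = ρ(s, a) + γ CVaR_α[V^π_{t+1}(s', α) | s' ~ τ(· | s, a)]`. -/
def icvarQ (M : CostMDP S A) (π : Policy S A) (α : ℝ) (T t : ℕ) (s : S) (a : A) : ℝ :=
  M.cost (s, a) + M.discount * cvar α (M.trans (s, a)) (M.icvarV π α T (t + 1))

theorem icvarV_eq (M : CostMDP S A) (π : Policy S A) (α : ℝ) {T t : ℕ} (h : t ≤ T) (s : S) :
    M.icvarV π α T t s = M.icvarQ π α T t s ((π t).1 s) := by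
  rw [icvarV, if_neg (not_lt.mpr h), icvarQ]

/-- One call of `EstimateQ` at `(s, a)`, given the law `K` of the output of `EstimateV` at the
next time step: `Nb` times independently, a successor `s'ᵢ ~ τ(· | s, a)` is drawn and then
`v̂ᵢ ~ K s'ᵢ`; the output is `ρ(s, a) + γ Ĉ_α(v̂₁, …, v̂_Nb)`. -/
def estimateStep (M : CostMDP S A) (α : ℝ) (Nb : ℕ) (K : Kernel S ℝ) [IsMarkovKernel K] :
    Kernel (S × A) ℝ :=
  (Kernel.id ×ₖ piKernel fun _ : Fin Nb => M.trans ⊗ₖ K.prodMkLeft (S × A)).map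
    fun p : (S × A) × (Fin Nb → S × ℝ) =>
      M.cost p.1 + M.discount * empCVaR α fun i => (p.2 i).2

instance estimateStep.isMarkovKernel (M : CostMDP S A) (α : ℝ) (Nb : ℕ) (K : Kernel S ℝ)
    [IsMarkovKernel K] : IsMarkovKernel (M.estimateStep α Nb K) := by
  refine Kernel.IsMarkovKernel.map _ ?_
  have := measurable_empCVaR (n := Nb) α
  have := M.measurable_cost
  fun_prop

/-- The law of the output `V̂^π_t(s, α)` of the recursive procedure `EstimateV`, as a Markov
kernel in `s`: the output is `0` for `t > T`, and that of `EstimateQ` at `(s, π_t(s))` for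
`t ≤ T`. -/
def estimateV (M : CostMDP S A) (π : Policy S A) (α : ℝ) (Nb T t : ℕ) :
    {K : Kernel S ℝ // IsMarkovKernel K} :=
  if T < t then ⟨Kernel.const S (Measure.dirac 0), inferInstance⟩
  else
    let K := estimateV M π α Nb T (t + 1)
    haveI := K.2
    ⟨(M.estimateStep α Nb K.1).comap (fun s => (s, (π t).1 s))
      (measurable_id.prodMk (π t).2), inferInstance⟩
  termination_by T + 1 - t

/-- The law of the output `Q̂^π_t(s, a, α)` of the recursive procedure `EstimateQ`. -/
def estimateQ (M : CostMDP S A) (π : Policy S A) (α : ℝ) (Nb T t : ℕ) (s : S) (a : A) :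
    Measure ℝ :=
  haveI := (M.estimateV π α Nb T (t + 1)).2
  M.estimateStep α Nb (M.estimateV π α Nb T (t + 1)).1 (s, a)

end CostMDP

/-! ### POMDPs and the particle-belief MDP -/

/-- A POMDP with measurable state, action and observation spaces. The observation model has
the density `obsDensity (a, x') z = Z(z | a, x')` with respect to the reference measure `obsRef`
(counting measure for discrete observations); it may depend on the action. -/
structure POMDP (X A Z : Type*) [MeasurableSpace X] [MeasurableSpace A] [MeasurableSpace Z] where
  trans : Kernel (X × A) X
  trans_markov : IsMarkovKernel trans
  obsRef : Measure Z
  obsRef_sfinite : SFinite obsRef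
  obsDensity : A × X → Z → ℝ≥0
  measurable_obsDensity : Measurable (Function.uncurry obsDensity)
  lintegral_obsDensity : ∀ p, ∫⁻ z, obsDensity p z ∂obsRef = 1
  cost : X × A → ℝ
  measurable_cost : Measurable cost
  discount : ℝ

/-- The set `Σ` of particle beliefs `{(xᵢ, wᵢ)}` with `N` particles, weights `wᵢ ≥ 0` and at
least one positive weight. -/
abbrev ParticleBelief (X : Type*) (N : ℕ) : Type _ :=
  {b : Fin N → X × ℝ≥0 // ∃ i, 0 < (b i).2}

theorem ParticleBelief.measurable_apply {X : Type*} [MeasurableSpace X] {N : ℕ} (i : Fin N) :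
    Measurable fun b : ParticleBelief X N => b.1 i :=
  (measurable_pi_apply i).comp measurable_subtype_coe

theorem ParticleBelief.measurableSet (X : Type*) [MeasurableSpace X] (N : ℕ) :
    MeasurableSet {b : Fin N → X × ℝ≥0 | ∃ i, 0 < (b i).2} := by
  rw [Set.ofPred_exists]
  exact MeasurableSet.iUnion fun i => measurableSet_lt (by fun_prop) (by fun_prop)

theorem ParticleBelief.range_val (X : Type*) (N : ℕ) :
    Set.range (Subtype.val : ParticleBelief X N → Fin N → X × ℝ≥0) =
      {b | ∃ i, 0 < (b i).2} := by
  ext b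
  simp

theorem ParticleBelief.measurableEmbedding (X : Type*) [MeasurableSpace X] (N : ℕ) :
    MeasurableEmbedding (Subtype.val : ParticleBelief X N → Fin N → X × ℝ≥0) :=
  MeasurableEmbedding.subtype_coe (ParticleBelief.measurableSet X N)

namespace POMDP

variable {X A Z : Type*} [MeasurableSpace X] [MeasurableSpace A] [MeasurableSpace Z]

instance (M : POMDP X A Z) : IsMarkovKernel M.trans := M.trans_markov

instance (M : POMDP X A Z) : SFinite M.obsRef := M.obsRef_sfinite

/-- The observation kernel: the law `Z(· | a, x')` of the observation. -/
def obs (M : POMDP X A Z) : Kernel (A × X) Z :=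
  (Kernel.const (A × X) M.obsRef).withDensity fun p z => (M.obsDensity p z : ℝ≥0∞)

instance obs.isMarkovKernel (M : POMDP X A Z) : IsMarkovKernel M.obs := by
  have hm : Measurable (Function.uncurry fun p z => (M.obsDensity p z : ℝ≥0∞)) :=
    measurable_coe_nnreal_ennreal.comp M.measurable_obsDensity
  refine ⟨fun p => ⟨?_⟩⟩
  rw [obs, Kernel.withDensity_apply' _ hm]
  simpa using M.lintegral_obsDensity p

/-- The observation produced by the generative model `G(x, a)`: a next state
`x' ~ T(· | x, a)` is drawn, then `z ~ Z(· | a, x')`. -/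
def genObs (M : POMDP X A Z) : Kernel (X × A) Z :=
  (M.trans ⊗ₖ M.obs.comap (fun p : (X × A) × X => (p.1.2, p.2)) (by fun_prop)).snd

instance genObs.isMarkovKernel (M : POMDP X A Z) : IsMarkovKernel M.genObs := by
  unfold genObs; infer_instance

/-- A state drawn from the particle belief: `xᵢ` with probability `wᵢ / ∑ⱼ wⱼ`. -/
def drawState (X : Type*) [MeasurableSpace X] (N : ℕ) : Kernel (ParticleBelief X N) X where
  toFun b := ∑ i, ((b.1 i).2 / ∑ j, (b.1 j).2) • Measure.dirac (b.1 i).1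
  measurable' := by
    refine Measure.measurable_of_measurable_coe _ fun s hs => ?_
    simp only [Measure.coe_finsetSum, Finset.sum_apply, Measure.smul_apply]
    refine Finset.measurable_sum _ fun i _ => ?_
    have hw : ∀ i, Measurable fun b : ParticleBelief X N => (b.1 i).2 := fun i =>
      (ParticleBelief.measurable_apply i).snd
    have hd : Measurable fun b : ParticleBelief X N => Measure.dirac (b.1 i).1 s :=
      (Measure.measurable_coe hs).comp
        (Measure.measurable_dirac.comp (ParticleBelief.measurable_apply i).fst)
    exact ((hw i).div (Finset.measurable_sum _ fun j _ => hw j)).smul hd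

instance drawState.isMarkovKernel (X : Type*) [MeasurableSpace X] (N : ℕ) :
    IsMarkovKernel (drawState X N) := by
  refine ⟨fun b => ⟨?_⟩⟩
  obtain ⟨i, hi⟩ := b.2
  have hpos : (∑ j, (b.1 j).2) ≠ 0 :=
    (lt_of_lt_of_le hi (Finset.single_le_sum (f := fun j => (b.1 j).2)
      (fun j _ => zero_le) (Finset.mem_univ i))).ne'
  change (∑ i, ((b.1 i).2 / ∑ j, (b.1 j).2) • Measure.dirac (b.1 i).1 : Measure X) Set.univ = 1
  simp only [Measure.coe_finsetSum, Finset.sum_apply, Measure.smul_apply, measure_univ,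
    ENNReal.smul_def, smul_eq_mul, mul_one]
  rw [← ENNReal.ofNNReal_finsetSum, ← Finset.sum_div, div_self hpos, ENNReal.coe_one]

/-- The observation used by `GenPF`: `x₀` is drawn from the belief, then `z` from `G(x₀, a)`. -/
def beliefObs (M : POMDP X A Z) (N : ℕ) : Kernel (ParticleBelief X N × A) Z :=
  ((drawState X N).prodMkRight A ⊗ₖ
    M.genObs.comap (fun p : (ParticleBelief X N × A) × X => (p.2, p.1.2)) (by fun_prop)).snd

instance beliefObs.isMarkovKernel (M : POMDP X A Z) (N : ℕ) :
    IsMarkovKernel (M.beliefObs N) := by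
  unfold beliefObs; infer_instance

/-- The propagated particles of `GenPF`: independently `x'ᵢ ~ T(· | xᵢ, a)`. -/
def propagate (M : POMDP X A Z) (N : ℕ) : Kernel (ParticleBelief X N × A) (Fin N → X) :=
  piKernel fun i : Fin N =>
    M.trans.comap (fun p : ParticleBelief X N × A => ((p.1.1 i).1, p.2))
      (((ParticleBelief.measurable_apply i).fst.comp measurable_fst).prodMk measurable_snd)

instance propagate.isMarkovKernel (M : POMDP X A Z) (N : ℕ) :
    IsMarkovKernel (M.propagate N) := by
  unfold propagate; infer_instance

/-- The particle-filter step `GenPF`: with `z` and `x'₁, …, x'_N` drawn independently as above,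
the new weighted particles are `(x'ᵢ, wᵢ · Z(z | a, x'ᵢ))`. -/
def genPF (M : POMDP X A Z) (N : ℕ) :
    Kernel (ParticleBelief X N × A) (Fin N → X × ℝ≥0) :=
  (Kernel.id ×ₖ (M.beliefObs N ×ₖ M.propagate N)).map
    fun p : (ParticleBelief X N × A) × (Z × (Fin N → X)) => fun i =>
      (p.2.2 i, (p.1.1.1 i).2 * M.obsDensity (p.1.2, p.2.2 i) p.2.1)

instance genPF.isMarkovKernel (M : POMDP X A Z) (N : ℕ) : IsMarkovKernel (M.genPF N) := by
  refine Kernel.IsMarkovKernel.map _ ?_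
  have h := M.measurable_obsDensity
  refine measurable_pi_lambda _ fun i => Measurable.prodMk (by fun_prop) ?_
  refine Measurable.mul
    ((ParticleBelief.measurable_apply i).snd.comp (measurable_fst.comp measurable_fst)) ?_
  exact h.comp (f := fun p : (ParticleBelief X N × A) × (Z × (Fin N → X)) =>
    ((p.1.2, p.2.2 i), p.2.1)) (by fun_prop)

/-- `GenPF` almost surely produces an element of `Σ`, i.e. the updated weights do not all
vanish, so that it defines a transition probability on `Σ`. -/
def Nondegenerate (M : POMDP X A Z) (N : ℕ) : Prop :=
  ∀ (b : ParticleBelief X N) (a : A), ∀ᵐ b' ∂(M.genPF N (b, a)), ∃ i, 0 < (b' i).2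

/-- The belief transition `τ(b' | b, a)`: the law of the output of `GenPF`, as a kernel on `Σ`. -/
def beliefTrans (M : POMDP X A Z) (N : ℕ) :
    Kernel (ParticleBelief X N × A) (ParticleBelief X N) :=
  (M.genPF N).comapRight (ParticleBelief.measurableEmbedding X N)

/-- The cost `ρ(b, a) = (∑ᵢ wᵢ c(xᵢ, a)) / ∑ᵢ wᵢ` of a particle belief. -/
def beliefCost (M : POMDP X A Z) (N : ℕ) (p : ParticleBelief X N × A) : ℝ :=
  (∑ i, ((p.1.1 i).2 : ℝ) * M.cost ((p.1.1 i).1, p.2)) / ∑ i, ((p.1.1 i).2 : ℝ)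

/-- The particle-belief MDP `M_P = (Σ, A, τ, ρ, γ)` of the POMDP `M` with `N` particles. -/
def particleBeliefMDP (M : POMDP X A Z) (N : ℕ) (h : M.Nondegenerate N) :
    CostMDP (ParticleBelief X N) A where
  trans := M.beliefTrans N
  trans_markov := by
    refine Kernel.IsMarkovKernel.comapRight _ _ fun p => ?_
    rw [ParticleBelief.range_val]
    exact (mem_ae_iff_prob_eq_one (ParticleBelief.measurableSet X N)).mp (h p.1 p.2)
  cost := M.beliefCost N
  measurable_cost := by
    have hw : ∀ i, Measurable fun p : ParticleBelief X N × A => ((p.1.1 i).2 : ℝ) := fun i =>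
      ((ParticleBelief.measurable_apply i).snd.comp measurable_fst).coe_nnreal_real
    refine Measurable.div (Finset.measurable_sum _ fun i _ => (hw i).mul ?_)
      (Finset.measurable_sum _ fun i _ => hw i)
    exact M.measurable_cost.comp
      (((ParticleBelief.measurable_apply i).fst.comp measurable_fst).prodMk measurable_snd)
  discount := M.discount

end POMDP

/-- `T_{α,t} = ∑_{k=0}^{T-t-1} (T - t - k) / α^k`. -/
def horizonFactor (α : ℝ) (T t : ℕ) : ℝ :=
  ∑ k ∈ Finset.range (T - t), ((T : ℝ) - t - k) / α ^ k

/-- `T'_{α,t} = ∑_{j=0}^{T-t-1} (T - t + 1 - j) / α^j`. -/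
def horizonFactor' (α : ℝ) (T t : ℕ) : ℝ :=
  ∑ j ∈ Finset.range (T - t), ((T : ℝ) - t + 1 - j) / α ^ j

end

/-! The estimate at one node errs for two reasons: `Nb` samples replace the law of the successor,
and estimates replace the exact values at the sampled successors. Comparing both CVaRs with the
empirical CVaR of the exact values at the sampled successors separates the two.

The second error passes through undamaged: empirical CVaR is monotone and commutes with
translations, so it costs no factor `1 / α` (`empCVaR_sub_le`). The first is a concentration bound
for bounded variables, applied to exact values whose range is the number of remaining levels times
`Rmax - Rmin` (`icvarV_mem_Icc`). A union bound over the root and its `Nb` children, iterated, gives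
failure probability `d * ∑ Nb ^ k` and error factor `∑ (n - k)` (`measureReal_estimateQ_le`). Taking
`d = δ / ∑ Nb ^ k` produces the logarithms; the stated horizon factors only enlarge `∑ (n - k)`.

Concentration rests on duality: CVaR is `1 / α` times the mean of `g * Y`, where `g` takes values in
`[0, 1]` and has mean `α`. For underestimation, the same weight is evaluated on the sample, with
missing mass put at `a` or excess mass removed at `b`; this leaves two sums of variables in `[0, 1]`
of mean at most `α`, to which a Bernstein bound applies. For overestimation, the empirical objective
at the true minimiser is controlled by Hoeffding's bound. -/

/-! ### Elementary properties of the empirical CVaR -/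

/-- Weak duality for the empirical CVaR: relative weights `g i ∈ [0, 1]` give a lower bound. -/
theorem le_empCVaR_objective {n : ℕ} (hn : 0 < n) {α : ℝ} (hα₀ : 0 < α) (hα₁ : α ≤ 1)
    {a b : ℝ} {y g : Fin n → ℝ} (hy : ∀ i, y i ∈ Set.Icc a b) (hg : ∀ i, g i ∈ Set.Icc 0 1)
    (w : ℝ) :
    min (a + 1 / (n * α) * ∑ i, g i * (y i - a)) (b - 1 / (n * α) * ∑ i, g i * (b - y i)) ≤
      w + 1 / (n * α) * ∑ i, max (y i - w) 0 := by
  have hn' : (0 : ℝ) < n := by exact_mod_cast hn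
  have hc : 0 < 1 / (n * α) := by positivity
  set c := 1 / (n * α) with hc_def
  have hcn : 1 ≤ c * n := by
    rw [hc_def, one_div, mul_inv, mul_comm, ← mul_assoc, mul_inv_cancel₀ hn'.ne', one_mul]
    exact (one_le_inv₀ hα₀).mpr hα₁
  -- Outside `[a, b]` the objective is bounded directly; for `w ≤ a` this uses that `c * n = 1 / α`
  -- is at least `1`. Inside, the lower bound is affine in `w` with slope `1 - c * ∑ g`, so it is
  -- smallest at `a` or at `b` according to the sign.
  rcases le_total w a with hw | hw
  · refine min_le_of_left_le ?_
    have h1 : ∑ i, (g i * (y i - a) + (a - w)) ≤ ∑ i, max (y i - w) 0 := by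
      refine Finset.sum_le_sum fun i _ => le_max_of_le_left ?_
      nlinarith [(hy i).1, (hg i).2]
    rw [Finset.sum_add_distrib, Finset.sum_const, Finset.card_univ, Fintype.card_fin,
      nsmul_eq_mul] at h1
    nlinarith [mul_le_mul_of_nonneg_left h1 hc.le, mul_nonneg (sub_nonneg.2 hcn) (sub_nonneg.2 hw)]
  rcases le_total b w with hw' | hw'
  · refine min_le_of_right_le ?_
    have h1 : 0 ≤ ∑ i, g i * (b - y i) :=
      Finset.sum_nonneg fun i _ => mul_nonneg (hg i).1 (sub_nonneg.2 (hy i).2)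
    have h2 : 0 ≤ ∑ i, max (y i - w) 0 := Finset.sum_nonneg fun i _ => le_max_right _ _
    nlinarith [mul_nonneg hc.le h1, mul_nonneg hc.le h2]
  · have h1 : ∑ i, g i * (y i - w) ≤ ∑ i, max (y i - w) 0 := by
      refine Finset.sum_le_sum fun i _ => ?_
      rcases le_total (y i) w with h | h
      · exact le_max_of_le_right (mul_nonpos_of_nonneg_of_nonpos (hg i).1 (sub_nonpos.2 h))
      · exact le_max_of_le_left (mul_le_of_le_one_left (sub_nonneg.2 h) (hg i).2)
    have h2 : ∀ v, ∑ i, g i * (y i - v) = ∑ i, g i * y i - (∑ i, g i) * v := fun v => by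
      simp only [mul_sub, Finset.sum_sub_distrib, Finset.sum_mul]
    have h3 : ∑ i, g i * (b - y i) = (∑ i, g i) * b - ∑ i, g i * y i := by
      simp only [mul_sub, Finset.sum_sub_distrib, Finset.sum_mul]
    have h4 := mul_le_mul_of_nonneg_left h1 hc.le
    rw [h2] at h4
    rw [h2, h3]
    rcases le_total (c * ∑ i, g i) 1 with hG | hG
    · refine min_le_of_left_le ?_
      nlinarith [mul_nonneg (sub_nonneg.2 hG) (sub_nonneg.2 hw)]
    · refine min_le_of_right_le ?_
      nlinarith [mul_nonneg (sub_nonneg.2 hG) (sub_nonneg.2 hw')]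

theorem le_empCVaR {n : ℕ} (hn : 0 < n) {α : ℝ} (hα₀ : 0 < α) (hα₁ : α ≤ 1)
    {a b : ℝ} {y g : Fin n → ℝ} (hy : ∀ i, y i ∈ Set.Icc a b) (hg : ∀ i, g i ∈ Set.Icc 0 1) :
    min (a + 1 / (n * α) * ∑ i, g i * (y i - a)) (b - 1 / (n * α) * ∑ i, g i * (b - y i)) ≤
      empCVaR α y :=
  le_ciInf (le_empCVaR_objective hn hα₀ hα₁ hy hg)

theorem bddBelow_empCVaR_objective {n : ℕ} (hn : 0 < n) {α : ℝ} (hα₀ : 0 < α) (hα₁ : α ≤ 1)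
    (y : Fin n → ℝ) :
    BddBelow (Set.range fun w : ℝ => w + 1 / (n * α) * ∑ i, max (y i - w) 0) := by
  -- With `g = 0` the dual bound is `min a b`, so any box containing the sample gives a lower bound.
  refine ⟨_, Set.forall_mem_range.2 fun w => le_empCVaR_objective hn hα₀ hα₁
    (a := -∑ i, |y i|) (b := ∑ i, |y i|) (g := fun _ => 0) (fun i => ?_) (fun i => by simp) w⟩
  exact abs_le.1 (Finset.single_le_sum (f := fun i => |y i|) (fun _ _ => abs_nonneg _)
    (Finset.mem_univ i))

theorem empCVaR_mem_Icc {n : ℕ} (hn : 0 < n) {α : ℝ} (hα₀ : 0 < α) (hα₁ : α ≤ 1)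
    {a b : ℝ} {y : Fin n → ℝ} (hy : ∀ i, y i ∈ Set.Icc a b) : empCVaR α y ∈ Set.Icc a b := by
  constructor
  · have h := le_empCVaR hn hα₀ hα₁ hy (g := fun _ => 0) (fun i => by simp)
    have hab : a ≤ b := (hy ⟨0, hn⟩).1.trans (hy ⟨0, hn⟩).2
    simpa [hab] using h
  · refine (ciInf_le (bddBelow_empCVaR_objective hn hα₀ hα₁ y) b).trans (le_of_eq ?_)
    have : ∀ i, max (y i - b) 0 = 0 := fun i => max_eq_right (sub_nonpos.2 (hy i).2)
    simp [this]

/-- Moving the threshold from `w` to `w + ε` absorbs the perturbation in the positive parts, so the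
objective grows by exactly `ε` at most. -/
theorem empCVaR_sub_le {n : ℕ} (hn : 0 < n) {α : ℝ} (hα₀ : 0 < α) (hα₁ : α ≤ 1)
    {y v : Fin n → ℝ} {ε : ℝ} (h : ∀ i, y i - v i ≤ ε) : empCVaR α y - empCVaR α v ≤ ε := by
  rw [sub_le_comm]
  refine le_ciInf fun w => ?_
  have h1 := ciInf_le (bddBelow_empCVaR_objective hn hα₀ hα₁ y) (w + ε)
  have h2 : 1 / (n * α) * ∑ i, max (y i - (w + ε)) 0 ≤ 1 / (n * α) * ∑ i, max (v i - w) 0 := by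
    gcongr 1 / (n * α) * ∑ i, max ?_ 0 with i
    linarith [h i]
  rw [empCVaR]
  linarith

/-! ### Elementary properties of CVaR -/

section CVaR

variable {Ω : Type*} [MeasurableSpace Ω] {μ : Measure Ω} [IsProbabilityMeasure μ]
  {α a b : ℝ} {Y : Ω → ℝ}

theorem integrable_max_sub (hY : Integrable Y μ) (w : ℝ) :
    Integrable (fun ω => max (Y ω - w) 0) μ :=
  (hY.sub (integrable_const w)).pos_part

theorem le_cvar_objective (hα₀ : 0 < α) (hα₁ : α ≤ 1) (hYm : Measurable Y)
    (hY : ∀ ω, Y ω ∈ Set.Icc a b) (w : ℝ) :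
    a ≤ w + 1 / α * ∫ ω, max (Y ω - w) 0 ∂μ := by
  have hi : Integrable Y μ := .of_mem_Icc a b hYm.aemeasurable (.of_forall hY)
  have h1 : max (a - w) 0 ≤ ∫ ω, max (Y ω - w) 0 ∂μ := by
    have := integral_mono (μ := μ) (integrable_const (max (a - w) 0)) (integrable_max_sub hi w)
      fun ω => max_le_max (sub_le_sub_right (hY ω).1 w) le_rfl
    simpa using this
  have h2 : 1 ≤ 1 / α := by rwa [le_div_iff₀ hα₀, one_mul]
  have h3 := le_max_left (a - w) 0
  have h4 := le_max_right (a - w) 0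
  nlinarith

theorem bddBelow_cvar_objective (hα₀ : 0 < α) (hα₁ : α ≤ 1) (hYm : Measurable Y)
    (hY : ∀ ω, Y ω ∈ Set.Icc a b) :
    BddBelow (Set.range fun w : ℝ => w + 1 / α * ∫ ω, max (Y ω - w) 0 ∂μ) :=
  ⟨a, Set.forall_mem_range.2 (le_cvar_objective hα₀ hα₁ hYm hY)⟩

theorem cvar_mem_Icc (hα₀ : 0 < α) (hα₁ : α ≤ 1) (hYm : Measurable Y)
    (hY : ∀ ω, Y ω ∈ Set.Icc a b) : cvar α μ Y ∈ Set.Icc a b := by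
  refine ⟨le_ciInf (le_cvar_objective hα₀ hα₁ hYm hY),
    (ciInf_le (bddBelow_cvar_objective (μ := μ) hα₀ hα₁ hYm hY) b).trans (le_of_eq ?_)⟩
  have : ∀ ω, max (Y ω - b) 0 = 0 := fun ω => max_eq_right (sub_nonpos.2 (hY ω).2)
  simp [this]

theorem continuous_integral_max_sub (hY : Integrable Y μ) :
    Continuous fun w : ℝ => ∫ ω, max (Y ω - w) 0 ∂μ := by
  refine (LipschitzWith.of_dist_le_mul (K := 1) fun v w => ?_).continuous
  rw [Real.dist_eq, ← integral_sub (integrable_max_sub hY v) (integrable_max_sub hY w)]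
  refine (norm_integral_le_of_norm_le_const (μ := μ) (C := |v - w|)
    (f := fun ω => max (Y ω - v) 0 - max (Y ω - w) 0) (.of_forall fun ω => ?_)).trans ?_
  · refine (abs_max_sub_max_le_abs _ _ _).trans (le_of_eq ?_)
    rw [abs_sub_comm v w]
    congr 1
    ring
  · simp [Real.dist_eq]

/-- The objective is continuous in the threshold, so the infimum may be taken over the rationals and
is a countable one. -/
theorem measurable_cvar_kernel {S : Type*} [MeasurableSpace S] {κ : Kernel S Ω}
    [IsMarkovKernel κ] (α : ℝ) (hYm : Measurable Y) (hY : ∀ ω, Y ω ∈ Set.Icc a b) :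
    Measurable fun s => cvar α (κ s) Y := by
  have h : (fun s => cvar α (κ s) Y) = fun s => ⨅ q : ℚ,
      ((q : ℝ) + 1 / α * ∫ ω, max (Y ω - (q : ℝ)) 0 ∂(κ s)) := by
    funext s
    have hi : Integrable Y (κ s) := .of_mem_Icc a b hYm.aemeasurable (.of_forall hY)
    have hc : Continuous fun w : ℝ => w + 1 / α * ∫ ω, max (Y ω - w) 0 ∂(κ s) :=
      continuous_id.add (continuous_const.mul (continuous_integral_max_sub hi))
    have hd := Dense.ciInf' (S := Set.range ((↑) : ℚ → ℝ)) Rat.denseRange_cast hc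
    rw [cvar, ← hd]
    simp only [iInf, Set.range]
    congr 1
    ext r
    simp
  rw [h]
  refine Measurable.iInf fun q => ?_
  have : Measurable fun ω => max (Y ω - (q : ℝ)) 0 := by fun_prop
  exact (this.stronglyMeasurable.integral_kernel.measurable.const_mul _).const_add _

theorem cvar_map {S : Type*} [MeasurableSpace S] {ν : Measure S} {f : S → Ω} (hf : Measurable f)
    (α : ℝ) (hYm : Measurable Y) : cvar α (ν.map f) Y = cvar α ν (Y ∘ f) := by
  unfold cvar
  refine iInf_congr fun w => ?_
  have : Measurable fun ω => max (Y ω - w) 0 := by fun_prop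
  rw [integral_map hf.aemeasurable this.aestronglyMeasurable]
  rfl

/-- A lower and upper `(1 - α)`-quantile of a bounded random variable. -/
theorem exists_quantile (hα₁ : α ≤ 1) (hα₀ : 0 < α) (hYm : Measurable Y)
    (hY : ∀ ω, Y ω ∈ Set.Icc a b) :
    ∃ q, μ.real {ω | q < Y ω} ≤ α ∧ α ≤ μ.real {ω | q ≤ Y ω} := by
  -- The quantile is `sInf S`. The constraint `a ≤ w` keeps `S` bounded below even when `α = 1`.
  -- Both inequalities follow from continuity of `μ` along increasing unions, approaching the
  -- infimum from above and from below.
  set S : Set ℝ := {w | a ≤ w ∧ μ.real {ω | w < Y ω} ≤ α} with hS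
  have hab : a ≤ b := by
    obtain ⟨ω⟩ : Nonempty Ω := nonempty_of_isProbabilityMeasure μ
    exact (hY ω).1.trans (hY ω).2
  have hne : S.Nonempty := by
    refine ⟨b, hab, ?_⟩
    have : {ω | b < Y ω} = ∅ := Set.eq_empty_of_forall_notMem fun ω h => (hY ω).2.not_gt h
    simp [this, hα₀.le]
  have hbd : BddBelow S := ⟨a, fun w hw => hw.1⟩
  obtain ⟨u, hu_anti, hu_pos, hu_lim⟩ := exists_seq_strictAnti_tendsto (0 : ℝ)
  refine ⟨sInf S, ?_, ?_⟩
  · have hU : {ω | sInf S < Y ω} = ⋃ n, {ω | sInf S + u n < Y ω} := by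
      ext ω
      simp only [Set.mem_ofPred_eq, Set.mem_iUnion]
      refine ⟨fun h => ?_, fun ⟨n, h⟩ => by linarith [hu_pos n]⟩
      obtain ⟨n, hn⟩ := (hu_lim.eventually_lt_const (sub_pos.2 h)).exists
      exact ⟨n, by linarith⟩
    have hmono : Monotone fun n => {ω | sInf S + u n < Y ω} := fun m n hmn ω h => by
      have := hu_anti.antitone hmn
      simp only [Set.mem_ofPred_eq] at h ⊢
      linarith
    refine ENNReal.toReal_le_of_le_ofReal hα₀.le ?_
    rw [hU, hmono.measure_iUnion]
    refine iSup_le fun n => ?_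
    obtain ⟨w, hw, hwn⟩ := exists_lt_of_csInf_lt hne (lt_add_of_pos_right (sInf S) (hu_pos n))
    refine (measure_mono (t := {ω | w < Y ω}) fun ω h => hwn.trans h).trans ?_
    exact ENNReal.le_ofReal_iff_toReal_le (measure_ne_top _ _) hα₀.le |>.2 hw.2
  · have hU : {ω | Y ω < sInf S} = ⋃ n, {ω | Y ω ≤ sInf S - u n} := by
      ext ω
      simp only [Set.mem_ofPred_eq, Set.mem_iUnion]
      refine ⟨fun h => ?_, fun ⟨n, h⟩ => by linarith [hu_pos n]⟩
      obtain ⟨n, hn⟩ := (hu_lim.eventually_lt_const (sub_pos.2 h)).exists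
      exact ⟨n, by linarith⟩
    have hmono : Monotone fun n => {ω | Y ω ≤ sInf S - u n} := fun m n hmn ω h => by
      have := hu_anti.antitone hmn
      simp only [Set.mem_ofPred_eq] at h ⊢
      linarith
    have hlt : μ.real {ω | Y ω < sInf S} ≤ 1 - α := by
      refine ENNReal.toReal_le_of_le_ofReal (sub_nonneg.2 hα₁) ?_
      rw [hU, hmono.measure_iUnion]
      refine iSup_le fun n => ?_
      refine ENNReal.le_ofReal_iff_toReal_le (measure_ne_top _ _) (sub_nonneg.2 hα₁) |>.2 ?_
      change μ.real _ ≤ _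
      -- A point below the infimum is outside `S` either because it lies below the range of `Y` or
      -- because its upper tail exceeds `α`.
      rcases lt_or_ge (sInf S - u n) a with h | h
      · have : {ω | Y ω ≤ sInf S - u n} = ∅ :=
          Set.eq_empty_of_forall_notMem fun ω hω => ((hY ω).1.trans hω).not_gt h
        simp [this, hα₁]
      · have hnot : sInf S - u n ∉ S := fun hmem => by
          linarith [csInf_le hbd hmem, hu_pos n]
        have h2 : α < μ.real {ω | sInf S - u n < Y ω} := by
          by_contra hcon
          exact hnot ⟨h, not_lt.1 hcon⟩
        have h3 : {ω | Y ω ≤ sInf S - u n} = {ω | sInf S - u n < Y ω}ᶜ := by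
          ext ω; simp
        rw [h3, probReal_compl_eq_one_sub (measurableSet_lt measurable_const hYm)]
        linarith
    have h3 : {ω | sInf S ≤ Y ω} = {ω | Y ω < sInf S}ᶜ := by
      ext ω; simp
    rw [h3, probReal_compl_eq_one_sub (measurableSet_lt hYm measurable_const)]
    linarith

/-- At a quantile the CVaR objective is the expectation under an admissible change of measure. -/
theorem exists_quantile_weight (hα₀ : 0 < α) (hα₁ : α ≤ 1) (hYm : Measurable Y)
    (hY : ∀ ω, Y ω ∈ Set.Icc a b) :
    ∃ (q : ℝ) (g : Ω → ℝ), Measurable g ∧ (∀ ω, g ω ∈ Set.Icc 0 1) ∧ ∫ ω, g ω ∂μ = α ∧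
      Integrable (fun ω => g ω * Y ω) μ ∧
      q + 1 / α * ∫ ω, max (Y ω - q) 0 ∂μ = 1 / α * ∫ ω, g ω * Y ω ∂μ := by
  obtain ⟨q, hq1, hq2⟩ := exists_quantile (μ := μ) hα₁ hα₀ hYm hY
  have hmlt : MeasurableSet {ω | q < Y ω} := measurableSet_lt measurable_const hYm
  have hmeq : MeasurableSet {ω | Y ω = q} := measurableSet_eq_fun hYm measurable_const
  have hsum : μ.real {ω | q ≤ Y ω} = μ.real {ω | q < Y ω} + μ.real {ω | Y ω = q} := by
    rw [← measureReal_union (Set.disjoint_left.2 fun ω h1 h2 => h1.ne' h2) hmeq]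
    congr 1
    ext ω
    simp [le_iff_lt_or_eq, eq_comm]
  -- `β` is the share of the atom at `q` that brings the mass of the upper tail to exactly `α`.
  obtain ⟨β, hβ, hβα⟩ : ∃ β ∈ Set.Icc (0 : ℝ) 1,
      μ.real {ω | q < Y ω} + β * μ.real {ω | Y ω = q} = α := by
    rcases (measureReal_nonneg (μ := μ) (s := {ω | Y ω = q})).eq_or_lt with h | h
    · exact ⟨0, by simp, by linarith⟩
    · refine ⟨(α - μ.real {ω | q < Y ω}) / μ.real {ω | Y ω = q},
        ⟨div_nonneg (by linarith) h.le, (div_le_one h).2 (by linarith)⟩, ?_⟩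
      rw [div_mul_cancel₀ _ h.ne']
      ring
  set g : Ω → ℝ := fun ω => {ω | q < Y ω}.indicator 1 ω + β * {ω | Y ω = q}.indicator 1 ω
  have hgm : Measurable g :=
    (measurable_one.indicator hmlt).add ((measurable_one.indicator hmeq).const_mul β)
  have hg : ∀ ω, g ω ∈ Set.Icc 0 1 := fun ω => by
    rcases lt_trichotomy q (Y ω) with h | h | h
    · simp [g, h, h.ne']
    · simpa [g, ← h] using hβ
    · simp [g, h.not_gt, h.ne]
  have hgint : ∫ ω, g ω ∂μ = α := by
    rw [integral_add, integral_const_mul, integral_indicator_one hmlt,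
      integral_indicator_one hmeq, hβα]
    · exact (integrable_const 1).indicator hmlt
    · exact ((integrable_const 1).indicator hmeq).const_mul β
  have hYi : Integrable Y μ := .of_mem_Icc a b hYm.aemeasurable (.of_forall hY)
  have hgi : Integrable g μ := .of_mem_Icc 0 1 hgm.aemeasurable (.of_forall hg)
  have hgYi : Integrable (fun ω => g ω * Y ω) μ :=
    hYi.bdd_mul hgm.aestronglyMeasurable (c := 1) (.of_forall fun ω => by
      rw [Real.norm_eq_abs, abs_of_nonneg (hg ω).1]; exact (hg ω).2)
  refine ⟨q, g, hgm, hg, hgint, hgYi, ?_⟩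
  -- The positive part equals `g * (Y - q)`: on the atom both sides vanish, whatever `β` is.
  have hpt : ∀ ω, max (Y ω - q) 0 = g ω * Y ω - q * g ω := fun ω => by
    rcases lt_trichotomy q (Y ω) with h | h | h
    · simp [g, h, h.ne', h.le]
    · simp [g, ← h, mul_comm]
    · simp [g, h.not_gt, h.ne, h.le]
  simp only [hpt]
  rw [integral_sub hgYi (hgi.const_mul q), integral_const_mul, hgint]
  field_simp
  ring

/-- Strong duality: the weight `g` attached to the quantile bounds the objective from below at every
`w`, with equality at `q`, so the infimum is attained there. -/
theorem exists_cvar_eq_objective (hα₀ : 0 < α) (hα₁ : α ≤ 1) (hYm : Measurable Y)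
    (hY : ∀ ω, Y ω ∈ Set.Icc a b) :
    ∃ q : ℝ, cvar α μ Y = q + 1 / α * ∫ ω, max (Y ω - q) 0 ∂μ := by
  obtain ⟨q, g, hgm, hg, hgα, hgYi, hq⟩ := exists_quantile_weight (μ := μ) hα₀ hα₁ hYm hY
  refine ⟨q, le_antisymm (ciInf_le (bddBelow_cvar_objective hα₀ hα₁ hYm hY) q) ?_⟩
  rw [hq]
  refine le_ciInf fun w => ?_
  have hYi : Integrable Y μ := .of_mem_Icc a b hYm.aemeasurable (.of_forall hY)
  have hgi : Integrable g μ := .of_mem_Icc 0 1 hgm.aemeasurable (.of_forall hg)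
  have h1 : ∫ ω, (g ω * Y ω - w * g ω) ∂μ ≤ ∫ ω, max (Y ω - w) 0 ∂μ := by
    refine integral_mono (hgYi.sub (hgi.const_mul w)) (integrable_max_sub hYi w) fun ω => ?_
    have h2 : g ω * Y ω - w * g ω = g ω * (Y ω - w) := by ring
    rw [h2]
    rcases le_total (Y ω) w with h | h
    · exact le_max_of_le_right (mul_nonpos_of_nonneg_of_nonpos (hg ω).1 (sub_nonpos.2 h))
    · exact le_max_of_le_left (mul_le_of_le_one_left (sub_nonneg.2 h) (hg ω).2)
  rw [integral_sub hgYi (hgi.const_mul w), integral_const_mul, hgα] at h1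
  have h2 := mul_le_mul_of_nonneg_left h1 (one_div_pos.2 hα₀).le
  have h3 : 1 / α * (∫ ω, g ω * Y ω ∂μ - w * α) = 1 / α * ∫ ω, g ω * Y ω ∂μ - w := by
    field_simp
  linarith

end CVaR

/-! ### Concentration of the empirical CVaR -/

section Concentration

variable {Ω : Type*} [MeasurableSpace Ω] {μ : Measure Ω} [IsProbabilityMeasure μ]

/-- Chernoff's bound for sums of independent copies of a random variable. -/
theorem measureReal_pi_le_sum_le_exp {f : Ω → ℝ} (hf : Integrable (fun ω => Real.exp (f ω)) μ)
    {c : ℝ} (hc : ∫ ω, Real.exp (f ω) ∂μ ≤ Real.exp c) (n : ℕ) (x : ℝ) :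
    (Measure.pi fun _ : Fin n => μ).real {ω | x ≤ ∑ i, f (ω i)} ≤ Real.exp (n * c - x) := by
  have hi : Integrable (fun ω : Fin n → Ω => ∏ i, Real.exp (f (ω i)))
      (Measure.pi fun _ : Fin n => μ) := Integrable.fintype_prod fun _ => hf
  have h := mul_meas_ge_le_integral_of_nonneg
    (.of_forall fun ω => Finset.prod_nonneg fun i _ => (Real.exp_pos (f (ω i))).le) hi (Real.exp x)
  rw [integral_fintype_prod_eq_pow (fun ω => Real.exp (f ω)), Fintype.card_fin] at h
  simp only [← Real.exp_sum, Real.exp_le_exp] at h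
  rw [Real.exp_sub, le_div_iff₀ (Real.exp_pos x), mul_comm, Real.exp_nat_mul]
  refine h.trans (pow_le_pow_left₀ (integral_nonneg fun ω => (Real.exp_pos _).le) hc n)

/-- A two-sided Bernstein-type bound for variables in `[0, 1]` with small mean. -/
theorem measureReal_pi_mul_sum_ge_le {h : Ω → ℝ} (hm : Measurable h)
    (h01 : ∀ ω, h ω ∈ Set.Icc 0 1) {α u σ : ℝ} (hmean : ∫ ω, h ω ∂μ ≤ α)
    (hu₀ : 0 ≤ u) (hu₁ : u ≤ 1) (hσ : σ = 1 ∨ σ = -1) (n : ℕ) :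
    (Measure.pi fun _ : Fin n => μ).real
      {ω | n * (α * u) ≤ σ * (∑ i, h (ω i) - n * ∫ ω, h ω ∂μ)} ≤
        Real.exp (-(n * (α * u ^ 2) / 4)) := by
  set m := ∫ ω, h ω ∂μ with hm_def
  set θ := σ * (u / 2) with hθ
  have hσ2 : σ * σ = 1 := by rcases hσ with rfl | rfl <;> norm_num
  have hθ2 : θ ^ 2 = u ^ 2 / 4 := by rw [hθ]; linear_combination (u ^ 2 / 4) * hσ2
  have hθabs : |θ| ≤ 1 := by
    rw [← sq_le_one_iff_abs_le_one, hθ2]; nlinarith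
  have hhi : Integrable h μ := .of_mem_Icc 0 1 hm.aemeasurable (.of_forall h01)
  -- From `exp x ≤ 1 + x + x ^ 2` for `|x| ≤ 1`, together with `h ^ 2 ≤ h`: the second-order term is
  -- then governed by the mean, not by the range.
  have hpt : ∀ ω, Real.exp (θ * h ω) ≤ 1 + (θ + θ ^ 2) * h ω := fun ω => by
    have habs : |θ * h ω| ≤ 1 := by
      rw [abs_mul, abs_of_nonneg (h01 ω).1]
      exact mul_le_one₀ hθabs (h01 ω).1 (h01 ω).2
    have h1 := (abs_le.1 (Real.abs_exp_sub_one_sub_id_le habs)).2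
    have h2 : h ω ^ 2 ≤ h ω := by nlinarith [(h01 ω).1, (h01 ω).2]
    nlinarith [sq_nonneg θ, mul_le_mul_of_nonneg_left h2 (sq_nonneg θ)]
  have hbi : Integrable (fun ω => 1 + (θ + θ ^ 2) * h ω) μ :=
    (integrable_const 1).add (hhi.const_mul _)
  have hei : Integrable (fun ω => Real.exp (θ * h ω)) μ := by
    refine hbi.mono' (by fun_prop) (.of_forall fun ω => ?_)
    rw [Real.norm_eq_abs, Real.abs_exp]
    exact hpt ω
  have hint : ∫ ω, Real.exp (θ * h ω) ∂μ ≤ Real.exp ((θ + θ ^ 2) * m) := by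
    refine (integral_mono hei hbi hpt).trans ?_
    rw [integral_add (integrable_const 1) (hhi.const_mul _), integral_const_mul]
    simpa [add_comm] using Real.add_one_le_exp ((θ + θ ^ 2) * m)
  -- The threshold is the event's inequality multiplied by `u / 2`. The exponent becomes `n * θ ^ 2
  -- * m - n * α * u ^ 2 / 2`, and `m ≤ α` leaves at most `-n * α * u ^ 2 / 4`.
  have hch := measureReal_pi_le_sum_le_exp hei hint n (n * (θ * m + α * u ^ 2 / 2))
  refine (measureReal_mono fun ω hω => ?_).trans (hch.trans (Real.exp_le_exp.2 ?_))
  · simp only [Set.mem_ofPred_eq] at hω ⊢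
    rw [← Finset.mul_sum]
    have := mul_le_mul_of_nonneg_left hω (by positivity : 0 ≤ u / 2)
    rw [hθ]
    linarith
  · rw [add_mul, hθ2]
    have : (n : ℝ) * (u ^ 2 * m) ≤ n * (u ^ 2 * α) := by gcongr
    linarith

/-- The optimal weight `g` for the true law is inserted in the weak dual bound for the sample. Its
sample mass need not be `α`, hence the minimum of two bounds, and failure of either is a Bernstein
event whose variance is of order `α`. -/
theorem measureReal_pi_empCVaR_lt_cvar_sub_le {n : ℕ} (hn : 0 < n) {α a b u : ℝ} (hα₀ : 0 < α)
    (hα₁ : α ≤ 1) {Y : Ω → ℝ} (hYm : Measurable Y) (hY : ∀ ω, Y ω ∈ Set.Icc a b) (hu₀ : 0 ≤ u) :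
    (Measure.pi fun _ : Fin n => μ).real
      {ω | (b - a) * u < cvar α μ Y - empCVaR α (fun i => Y (ω i))} ≤
        3 * Real.exp (-(n * (α * u ^ 2) / 5)) := by
  have hC := cvar_mem_Icc (μ := μ) hα₀ hα₁ hYm hY
  -- Both CVaRs lie in `[a, b]`, so larger deviations are impossible; what remains has `a < b` and
  -- `u ≤ 1`, as the Bernstein bound requires.
  by_cases htriv : b - a ≤ (b - a) * u
  · have hempty : {ω : Fin n → Ω | (b - a) * u < cvar α μ Y - empCVaR α (fun i => Y (ω i))} = ∅ :=
      Set.eq_empty_of_forall_notMem fun ω hω => by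
        rw [Set.mem_ofPred_eq] at hω
        linarith [hC.2, (empCVaR_mem_Icc hn hα₀ hα₁ fun i => hY (ω i)).1]
    rw [hempty, measureReal_empty]
    positivity
  have hR : 0 < b - a := by
    refine lt_of_le_of_ne (by linarith [hC.1, hC.2]) fun h => htriv ?_
    rw [← h]; simp
  have hu₁ : u ≤ 1 := by
    by_contra hcon
    exact htriv (le_mul_of_one_le_right hR.le (not_le.1 hcon).le)
  have hn' : (0 : ℝ) < n := by exact_mod_cast hn
  obtain ⟨q, g, hgm, hg, hgα, hgYi, hq⟩ := exists_quantile_weight (μ := μ) hα₀ hα₁ hYm hY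
  have hle := (ciInf_le (bddBelow_cvar_objective (μ := μ) hα₀ hα₁ hYm hY) q).trans_eq hq
  change cvar α μ Y ≤ _ at hle
  have hgi : Integrable g μ := .of_mem_Icc 0 1 hgm.aemeasurable (.of_forall hg)
  set D := ∫ ω, g ω * Y ω ∂μ with hD
  set h₁ : Ω → ℝ := fun ω => g ω * (Y ω - a) / (b - a) with hh₁
  set h₂ : Ω → ℝ := fun ω => g ω * (b - Y ω) / (b - a) with hh₂
  have hm₁ : Measurable h₁ := by fun_prop
  have hm₂ : Measurable h₂ := by fun_prop
  have h01₁ : ∀ ω, h₁ ω ∈ Set.Icc 0 1 := fun ω => by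
    refine ⟨div_nonneg (mul_nonneg (hg ω).1 (by linarith [(hY ω).1])) hR.le,
      (div_le_one hR).2 ?_⟩
    exact (mul_le_of_le_one_left (by linarith [(hY ω).1]) (hg ω).2).trans (by linarith [(hY ω).2])
  have h01₂ : ∀ ω, h₂ ω ∈ Set.Icc 0 1 := fun ω => by
    refine ⟨div_nonneg (mul_nonneg (hg ω).1 (by linarith [(hY ω).2])) hR.le,
      (div_le_one hR).2 ?_⟩
    exact (mul_le_of_le_one_left (by linarith [(hY ω).2]) (hg ω).2).trans (by linarith [(hY ω).1])
  have hint₁ : ∫ ω, h₁ ω ∂μ = (D - α * a) / (b - a) := by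
    simp only [hh₁, mul_sub]
    rw [integral_div, integral_sub hgYi (hgi.mul_const a), integral_mul_const, hgα]
  have hint₂ : ∫ ω, h₂ ω ∂μ = (α * b - D) / (b - a) := by
    simp only [hh₂, mul_sub]
    rw [integral_div, integral_sub (hgi.mul_const b) hgYi, integral_mul_const, hgα]
  have hmean : ∀ {h : Ω → ℝ}, Measurable h → (∀ ω, h ω ∈ Set.Icc 0 1) → (∀ ω, h ω ≤ g ω) →
      ∫ ω, h ω ∂μ ≤ α := fun {h} hm h01 hhg => by
    rw [← hgα]
    exact integral_mono (.of_mem_Icc 0 1 hm.aemeasurable (.of_forall h01)) hgi hhg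
  have hle₁ : ∫ ω, h₁ ω ∂μ ≤ α := hmean hm₁ h01₁ fun ω =>
    (div_le_iff₀ hR).2 (mul_le_mul_of_nonneg_left (by linarith [(hY ω).2]) (hg ω).1)
  have hle₂ : ∫ ω, h₂ ω ∂μ ≤ α := hmean hm₂ h01₂ fun ω =>
    (div_le_iff₀ hR).2 (mul_le_mul_of_nonneg_left (by linarith [(hY ω).1]) (hg ω).1)
  have ht₁ := measureReal_pi_mul_sum_ge_le hm₁ h01₁ hle₁ hu₀ hu₁ (.inr rfl) n
  have ht₂ := measureReal_pi_mul_sum_ge_le hm₂ h01₂ hle₂ hu₀ hu₁ (.inl rfl) n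
  have hsub : {ω : Fin n → Ω | (b - a) * u < cvar α μ Y - empCVaR α (fun i => Y (ω i))} ⊆
      {ω | n * (α * u) ≤ -1 * (∑ i, h₁ (ω i) - n * ∫ ω, h₁ ω ∂μ)} ∪
      {ω | n * (α * u) ≤ 1 * (∑ i, h₂ (ω i) - n * ∫ ω, h₂ ω ∂μ)} := fun ω hω => by
    simp only [Set.mem_ofPred_eq, Set.mem_union] at hω ⊢
    have hlow := le_empCVaR hn hα₀ hα₁ (fun i => hY (ω i)) (fun i => hg (ω i))
    have hs₁ : ∑ i, h₁ (ω i) = (∑ i, g (ω i) * (Y (ω i) - a)) / (b - a) := by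
      rw [Finset.sum_div]
    have hs₂ : ∑ i, h₂ (ω i) = (∑ i, g (ω i) * (b - Y (ω i))) / (b - a) := by
      rw [Finset.sum_div]
    rw [hint₁, hint₂, hs₁, hs₂]
    set s₁ := ∑ i, g (ω i) * (Y (ω i) - a)
    set s₂ := ∑ i, g (ω i) * (b - Y (ω i))
    rcases min_le_iff.1 hlow with h | h
    · left
      have h1 : a + 1 / (n * α) * s₁ ≤ 1 / α * D - (b - a) * u := by linarith
      have h2 := mul_le_mul_of_nonneg_left h1 (mul_pos hn' hα₀).le
      have e1 : n * α * (a + 1 / (n * α) * s₁) = n * α * a + s₁ := by field_simp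
      have e2 : n * α * (1 / α * D - (b - a) * u) = n * D - n * α * ((b - a) * u) := by
        field_simp
      rw [e1, e2] at h2
      have e3 : -1 * (s₁ / (b - a) - n * ((D - α * a) / (b - a))) =
        (n * (D - α * a) - s₁) / (b - a) := by ring
      rw [e3, le_div_iff₀ hR]
      linarith
    · right
      have h1 : b - 1 / (n * α) * s₂ ≤ 1 / α * D - (b - a) * u := by linarith
      have h2 := mul_le_mul_of_nonneg_left h1 (mul_pos hn' hα₀).le
      have e1 : n * α * (b - 1 / (n * α) * s₂) = n * α * b - s₂ := by field_simp
      have e2 : n * α * (1 / α * D - (b - a) * u) = n * D - n * α * ((b - a) * u) := by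
        field_simp
      rw [e1, e2] at h2
      have e3 : 1 * (s₂ / (b - a) - n * ((α * b - D) / (b - a))) =
        (s₂ - n * (α * b - D)) / (b - a) := by ring
      rw [e3, le_div_iff₀ hR]
      linarith
  refine (measureReal_mono hsub).trans ((measureReal_union_le _ _).trans ?_)
  -- The two tails already give `2 * exp (-n α u² / 4)`, which is weakened to the constants `3` and
  -- `5`.
  have hexp : Real.exp (-(n * (α * u ^ 2) / 4)) ≤ Real.exp (-(n * (α * u ^ 2) / 5)) := by
    refine Real.exp_le_exp.2 ?_
    have : 0 ≤ n * (α * u ^ 2) := by positivity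
    linarith
  linarith [Real.exp_pos (-(n * (α * u ^ 2) / 5))]

/-- The empirical CVaR is at most its objective at the minimiser `q` of the true one, so only the
sample mean of `(Y - q)⁺` has to concentrate. -/
theorem measureReal_pi_cvar_lt_empCVaR_sub_le {n : ℕ} (hn : 0 < n) {α a b u : ℝ} (hα₀ : 0 < α)
    (hα₁ : α ≤ 1) {Y : Ω → ℝ} (hYm : Measurable Y) (hY : ∀ ω, Y ω ∈ Set.Icc a b) (hu₀ : 0 ≤ u) :
    (Measure.pi fun _ : Fin n => μ).real
      {ω | (b - a) * u < empCVaR α (fun i => Y (ω i)) - cvar α μ Y} ≤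
        Real.exp (-(2 * n * (α * u) ^ 2)) := by
  have hC := cvar_mem_Icc (μ := μ) hα₀ hα₁ hYm hY
  rcases (sub_nonneg.2 (hC.1.trans hC.2)).eq_or_lt with hR | hR
  · have hempty : {ω : Fin n → Ω | (b - a) * u < empCVaR α (fun i => Y (ω i)) - cvar α μ Y} = ∅ :=
      Set.eq_empty_of_forall_notMem fun ω hω => by
        rw [Set.mem_ofPred_eq] at hω
        rw [← hR, zero_mul] at hω
        linarith [hC.1, (empCVaR_mem_Icc hn hα₀ hα₁ fun i => hY (ω i)).2]
    rw [hempty, measureReal_empty]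
    positivity
  have hn' : (0 : ℝ) < n := by exact_mod_cast hn
  obtain ⟨q, hq⟩ := exists_cvar_eq_objective (μ := μ) hα₀ hα₁ hYm hY
  set h : Ω → ℝ := fun ω => max (Y ω - q) 0
  have hm : Measurable h := by fun_prop
  have hsg := hasSubgaussianMGF_of_mem_Icc (μ := μ) hm.aemeasurable
    (a := max (a - q) 0) (b := max (b - q) 0) (.of_forall fun ω =>
      ⟨max_le_max (sub_le_sub_right (hY ω).1 q) le_rfl,
        max_le_max (sub_le_sub_right (hY ω).2 q) le_rfl⟩)
  -- This minimises the Chernoff exponent `n (b - a)² θ² / 8 - θ n α (b - a) u`.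
  set θ := 4 * (α * u) / (b - a) with hθ
  have hvar : (((‖max (b - q) 0 - max (a - q) 0‖₊ / 2) ^ 2 : ℝ≥0) : ℝ) ≤ ((b - a) / 2) ^ 2 := by
    push_cast
    gcongr
    refine (abs_max_sub_max_le_abs _ _ _).trans (le_of_eq ?_)
    rw [sub_sub_sub_cancel_right, abs_of_pos hR]
  have hint : ∫ ω, Real.exp (θ * (h ω - ∫ x, h x ∂μ)) ∂μ ≤
      Real.exp (((b - a) / 2) ^ 2 * θ ^ 2 / 2) := by
    refine (hsg.mgf_le θ).trans (Real.exp_le_exp.2 ?_)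
    gcongr
  have hch := measureReal_pi_le_sum_le_exp (hsg.integrable_exp_mul θ) hint n
    (θ * (n * α * ((b - a) * u)))
  refine (measureReal_mono fun ω hω => ?_).trans (hch.trans_eq ?_)
  · simp only [Set.mem_ofPred_eq] at hω ⊢
    rw [← Finset.mul_sum]
    refine mul_le_mul_of_nonneg_left ?_ (by positivity)
    have h1 := ciInf_le (bddBelow_empCVaR_objective hn hα₀ hα₁ fun i => Y (ω i)) q
    change empCVaR α (fun i => Y (ω i)) ≤ q + 1 / (n * α) * ∑ i, h (ω i) at h1
    change cvar α μ Y = q + 1 / α * ∫ x, h x ∂μ at hq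
    have h2 : (b - a) * u ≤ 1 / (n * α) * ∑ i, h (ω i) - 1 / α * ∫ x, h x ∂μ := by linarith
    have h3 := mul_le_mul_of_nonneg_left h2 (mul_pos hn' hα₀).le
    refine h3.trans_eq ?_
    rw [Finset.sum_sub_distrib, Finset.sum_const, Finset.card_univ, Fintype.card_fin,
      nsmul_eq_mul]
    field_simp
  · congr 1
    rw [hθ]
    field_simp
    ring

end Concentration

/-! ### Error propagation through the recursive estimator -/

namespace CostMDP

variable {S A : Type*} [MeasurableSpace S] [MeasurableSpace A]

instance estimateQ.isProbabilityMeasure (M : CostMDP S A) (π : Policy S A) (α : ℝ)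
    (Nb T t : ℕ) (s : S) (a : A) : IsProbabilityMeasure (M.estimateQ π α Nb T t s a) := by
  have := (M.estimateV π α Nb T (t + 1)).2
  unfold estimateQ
  infer_instance

theorem estimateStep_apply (M : CostMDP S A) (α : ℝ) (Nb : ℕ) (K : Kernel S ℝ)
    [IsMarkovKernel K] (p : S × A) :
    M.estimateStep α Nb K p =
      (Measure.pi fun _ : Fin Nb => (M.trans ⊗ₖ K.prodMkLeft (S × A)) p).map
        fun y => M.cost p + M.discount * empCVaR α fun i => (y i).2 := by
  have hm : Measurable fun p : (S × A) × (Fin Nb → S × ℝ) =>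
      M.cost p.1 + M.discount * empCVaR α fun i => (p.2 i).2 := by
    have := measurable_empCVaR (n := Nb) α
    have := M.measurable_cost
    fun_prop
  rw [estimateStep, Kernel.map_apply _ hm, Kernel.prod_apply, Kernel.id_apply,
    Measure.dirac_prod, Measure.map_map hm measurable_prodMk_left]
  rfl

theorem measureReal_compProd_le (M : CostMDP S A) (K : Kernel S ℝ) [IsMarkovKernel K]
    {B : Set (S × ℝ)} (hB : MeasurableSet B) {η : ℝ} (hη₀ : 0 ≤ η)
    (hη : ∀ s, (K s).real {v | (s, v) ∈ B} ≤ η) (p : S × A) :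
    ((M.trans ⊗ₖ K.prodMkLeft (S × A)) p).real B ≤ η := by
  refine ENNReal.toReal_le_of_le_ofReal hη₀ ?_
  rw [Kernel.compProd_apply hB]
  refine (lintegral_mono (g := fun _ => ENNReal.ofReal η) fun s => ?_).trans (by simp)
  rw [Kernel.prodMkLeft_apply]
  exact ENNReal.le_ofReal_iff_toReal_le (measure_ne_top _ _) hη₀ |>.2 (hη s)

/-- One level of the recursion: the deviation of the empirical CVaR of the exact values is
added to the errors made at the successors. -/
theorem measureReal_estimateStep_le (M : CostMDP S A) (hγ₀ : 0 ≤ M.discount) {α : ℝ}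
    (hα₀ : 0 < α) (hα₁ : α ≤ 1) {Nb : ℕ} (hNb : 0 < Nb) (K : Kernel S ℝ) [IsMarkovKernel K]
    {V : S → ℝ} (hV : Measurable V) {σ : ℝ} (hσ : σ = 1 ∨ σ = -1) {r e d η : ℝ}
    (hη₀ : 0 ≤ η) (hη : ∀ s, (K s).real {v | e < σ * (V s - v)} ≤ η) (p : S × A)
    (hd : ∀ ν : Measure (S × ℝ), IsProbabilityMeasure ν →
      (Measure.pi fun _ : Fin Nb => ν).real
        {y | r < σ * (cvar α ν (V ∘ Prod.fst) - empCVaR α fun i => V (y i).1)} ≤ d) :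
    (M.estimateStep α Nb K p).real
      {q | M.discount * (r + e) < σ * (M.cost p + M.discount * cvar α (M.trans p) V - q)} ≤
        d + Nb * η := by
  -- `ν` is the joint law of a successor and its estimate. Exact values depend on the first
  -- coordinate only, so the deviation bound applies under `ν` and no independence between the
  -- coordinates is needed.
  set ν := (M.trans ⊗ₖ K.prodMkLeft (S × A)) p with hν
  have hfst : ν.map Prod.fst = M.trans p := by
    rw [hν, ← Kernel.fst_apply, Kernel.fst_compProd]
  have hm : Measurable fun y : Fin Nb → S × ℝ =>
      M.cost p + M.discount * empCVaR α fun i => (y i).2 := by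
    have := measurable_empCVaR (n := Nb) α
    fun_prop
  rw [estimateStep_apply, map_measureReal_apply hm
    (measurableSet_lt measurable_const (by fun_prop)), ← hfst, cvar_map measurable_fst α hV]
  set B : Set (S × ℝ) := {x | e < σ * (V x.1 - x.2)} with hB_def
  have hB : MeasurableSet B := measurableSet_lt measurable_const (by fun_prop)
  -- If the exact values deviate by at most `r` and every child errs by at most `e`, the node errs
  -- by at most `γ (r + e)`.
  have hsub : (fun y : Fin Nb → S × ℝ => M.cost p + M.discount * empCVaR α fun i => (y i).2) ⁻¹'
      {q | M.discount * (r + e) <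
        σ * (M.cost p + M.discount * cvar α ν (V ∘ Prod.fst) - q)} ⊆
      {y | r < σ * (cvar α ν (V ∘ Prod.fst) - empCVaR α fun i => V (y i).1)} ∪
        ⋃ i, Function.eval i ⁻¹' B := fun y hy => by
    by_contra hcon
    simp only [Set.mem_union, Set.mem_iUnion, Set.mem_preimage, Set.mem_ofPred_eq, hB_def,
      Function.eval, not_or, not_exists, not_lt] at hcon hy
    obtain ⟨h1, h2⟩ := hcon
    have h3 : σ * (empCVaR α (fun i => V (y i).1) - empCVaR α fun i => (y i).2) ≤ e := by
      rcases hσ with rfl | rfl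
      · rw [one_mul]
        exact empCVaR_sub_le hNb hα₀ hα₁ fun i => by simpa using h2 i
      · rw [neg_one_mul, neg_sub]
        exact empCVaR_sub_le hNb hα₀ hα₁ fun i => by simpa using h2 i
    have h4 := mul_le_mul_of_nonneg_left (add_le_add h1 h3) hγ₀
    linarith
  refine (measureReal_mono hsub).trans ((measureReal_union_le _ _).trans
    (add_le_add (hd ν inferInstance) ((measureReal_iUnion_fintype_le _).trans ?_)))
  refine (Finset.sum_le_card_nsmul _ _ η fun i _ => ?_).trans_eq (by simp)
  rw [(measurePreserving_eval (fun _ : Fin Nb => ν) i).measureReal_preimage hB.nullMeasurableSet]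
  exact measureReal_compProd_le M K hB hη₀ hη p

/-- Only the width of the range matters for concentration, so its lower end is left free. As CVaR
stays within the range and `γ ≤ 1`, each level widens it by at most `Rmax - Rmin`. -/
theorem icvarV_mem_Icc (M : CostMDP S A) (hγ₀ : 0 ≤ M.discount) (hγ₁ : M.discount ≤ 1)
    {Rmin Rmax : ℝ} (hR : Rmin ≤ Rmax) (hc : ∀ p, M.cost p ∈ Set.Icc Rmin Rmax)
    (π : Policy S A) {α : ℝ} (hα₀ : 0 < α) (hα₁ : α ≤ 1) {T : ℕ} (n : ℕ) :
    ∀ t, t + n = T + 1 → Measurable (M.icvarV π α T t) ∧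
      ∃ lo, ∀ s, M.icvarV π α T t s ∈ Set.Icc lo (lo + n * (Rmax - Rmin)) := by
  induction n with
  | zero =>
    intro t ht
    have h : M.icvarV π α T t = fun _ => 0 := by
      funext s
      rw [icvarV, if_pos (by omega)]
    exact ⟨h ▸ measurable_const, 0, by simp [h]⟩
  | succ n ih =>
    intro t ht
    obtain ⟨hm, lo, hlo⟩ := ih (t + 1) (by omega)
    have h : M.icvarV π α T t = fun s => M.cost (s, (π t).1 s) +
        M.discount * cvar α (M.trans (s, (π t).1 s)) (M.icvarV π α T (t + 1)) := by
      funext s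
      rw [icvarV, if_neg (by omega)]
    have hπ : Measurable fun s => (s, (π t).1 s) := measurable_id.prodMk (π t).2
    refine ⟨?_, Rmin + M.discount * lo, fun s => ?_⟩
    · rw [h]
      exact (M.measurable_cost.comp hπ).add
        (((measurable_cvar_kernel α hm hlo).comp hπ).const_mul _)
    · have h1 := hc (s, (π t).1 s)
      have h2 := cvar_mem_Icc (μ := M.trans (s, (π t).1 s)) hα₀ hα₁ hm hlo
      rw [h]
      have h3 := mul_le_mul_of_nonneg_left h2.1 hγ₀
      have h4 := mul_le_mul_of_nonneg_left h2.2 hγ₀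
      have h5 : M.discount * (n * (Rmax - Rmin)) ≤ n * (Rmax - Rmin) :=
        mul_le_of_le_one_left (mul_nonneg n.cast_nonneg (sub_nonneg.2 hR)) hγ₁
      refine ⟨add_le_add h1.1 h3, ?_⟩
      push_cast
      linarith [h1.2]

/-- If the empirical CVaR of `Nb` samples deviates, in the direction `σ = ±1`, by more than `u`
times the range with probability at most `d`, then the recursive estimator with `n` remaining
levels deviates by more than `γ (Rmax - Rmin) u ∑_{k<n} (n - k)` with probability at most
`d ∑_{k<n} Nb ^ k`. -/
theorem measureReal_estimateQ_le (M : CostMDP S A) (hγ₀ : 0 ≤ M.discount) (hγ₁ : M.discount ≤ 1)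
    {Rmin Rmax : ℝ} (hR : Rmin ≤ Rmax) (hc : ∀ p, M.cost p ∈ Set.Icc Rmin Rmax)
    (π : Policy S A) {α : ℝ} (hα₀ : 0 < α) (hα₁ : α ≤ 1) {Nb : ℕ} (hNb : 0 < Nb)
    {σ : ℝ} (hσ : σ = 1 ∨ σ = -1) {u d : ℝ} (hu : 0 ≤ u) (hd₀ : 0 ≤ d) {T : ℕ} (n : ℕ)
    (hd : n ≠ 0 → ∀ (ν : Measure (S × ℝ)) [IsProbabilityMeasure ν] (Y : S × ℝ → ℝ) (a b : ℝ),
      Measurable Y → (∀ x, Y x ∈ Set.Icc a b) →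
      (Measure.pi fun _ : Fin Nb => ν).real
        {y | (b - a) * u < σ * (cvar α ν Y - empCVaR α fun i => Y (y i))} ≤ d) :
    ∀ t, t + n = T → ∀ s a,
      (M.estimateQ π α Nb T t s a).real
        {q | M.discount * (Rmax - Rmin) * u * ∑ k ∈ Finset.range n, ((n : ℝ) - k) <
          σ * (M.icvarQ π α T t s a - q)} ≤ d * ∑ k ∈ Finset.range n, (Nb : ℝ) ^ k := by
  induction n with
  | zero =>
    intro t ht s a
    have hV : M.icvarV π α T (t + 1) = fun _ => 0 := by
      funext s
      rw [icvarV, if_pos (by omega)]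
    have hK : (M.estimateV π α Nb T (t + 1)).1 = Kernel.const S (Measure.dirac 0) := by
      rw [estimateV, if_pos (by omega)]
    have := (M.estimateV π α Nb T (t + 1)).2
    -- At the horizon all successor values and estimates are zero, so the error vanishes almost
    -- surely and no concentration is used.
    have h := M.measureReal_estimateStep_le hγ₀ hα₀ hα₁ hNb (M.estimateV π α Nb T (t + 1)).1
      (V := fun _ => 0) measurable_const hσ (r := 0) (e := 0) (d := 0) (η := 0) le_rfl
      (fun s => by simp [hK, measureReal_def]) (s, a) fun ν hν => by
        have h1 := cvar_mem_Icc (μ := ν) (Y := (fun _ => 0 : S → ℝ) ∘ Prod.fst) (a := 0) (b := 0)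
          hα₀ hα₁ measurable_const (by simp)
        have h2 := empCVaR_mem_Icc (a := 0) (b := 0) hNb hα₀ hα₁ (y := fun _ : Fin Nb => (0 : ℝ))
          (by simp)
        rw [Set.Icc_self, Set.mem_singleton_iff] at h1 h2
        simp [h1, h2]
    simpa [estimateQ, icvarQ, hV] using h
  | succ n ih =>
    intro t ht s a
    obtain ⟨hm, lo, hlo⟩ := M.icvarV_mem_Icc hγ₀ hγ₁ hR hc π hα₀ hα₁ (T := T) (n + 1) (t + 1)
      (by omega)
    have := (M.estimateV π α Nb T (t + 1)).2
    have hη : ∀ s, ((M.estimateV π α Nb T (t + 1)).1 s).real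
        {v | M.discount * (Rmax - Rmin) * u * ∑ k ∈ Finset.range n, ((n : ℝ) - k) <
          σ * (M.icvarV π α T (t + 1) s - v)} ≤ d * ∑ k ∈ Finset.range n, (Nb : ℝ) ^ k := by
      intro s
      have h := ih (fun _ => hd n.succ_ne_zero) (t + 1) (by omega) s ((π (t + 1)).1 s)
      rw [icvarV_eq M π α (by omega)]
      rw [estimateV, if_neg (by omega)]
      exact h
    -- The values at time `t + 1` have range at most `(n + 1) (Rmax - Rmin)`, which gives the new
    -- summand of `∑ (n + 1 - k)`.
    have h := M.measureReal_estimateStep_le hγ₀ hα₀ hα₁ hNb (M.estimateV π α Nb T (t + 1)).1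
      hm hσ (r := ((n + 1 : ℕ) : ℝ) * (Rmax - Rmin) * u) (d := d) (by positivity) hη (s, a)
      fun ν hν => by
        have h := hd n.succ_ne_zero ν (M.icvarV π α T (t + 1) ∘ Prod.fst) _ _
          (hm.comp measurable_fst) fun x => hlo x.1
        simpa using h
    have hΔ : 0 ≤ Rmax - Rmin := sub_nonneg.2 hR
    have hsum : ∑ k ∈ Finset.range (n + 1), (((n + 1 : ℕ) : ℝ) - k) =
        (n + 1) + ∑ k ∈ Finset.range n, ((n : ℝ) - k) := by
      rw [Finset.sum_range_succ', add_comm]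
      simp
    have hnn : 0 ≤ ∑ k ∈ Finset.range n, ((n : ℝ) - k) :=
      Finset.sum_nonneg fun k hk => by
        have : (k : ℝ) ≤ n := by exact_mod_cast (Finset.mem_range.1 hk).le
        linarith
    refine (measureReal_mono fun q hq => ?_).trans (h.trans_eq ?_)
    · simp only [Set.mem_ofPred_eq, icvarQ] at hq ⊢
      refine lt_of_le_of_lt ?_ hq
      rw [hsum]
      -- The discount inherited from the children is dropped; a single factor `γ` is kept for the
      -- whole tree.
      have h1 : M.discount * ((Rmax - Rmin) * u * ∑ k ∈ Finset.range n, ((n : ℝ) - k)) ≤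
          (Rmax - Rmin) * u * ∑ k ∈ Finset.range n, ((n : ℝ) - k) :=
        mul_le_of_le_one_left (by positivity) hγ₁
      have h2 := mul_le_mul_of_nonneg_left h1 hγ₀
      push_cast
      linarith
    · rw [Finset.sum_range_succ']
      simp only [pow_succ, ← Finset.sum_mul, pow_zero]
      ring

end CostMDP

/-! ### Confidence bounds for the recursive estimator -/

theorem one_le_sum_pow {Nb n : ℕ} (hn : n ≠ 0) :
    1 ≤ ∑ k ∈ Finset.range n, (Nb : ℝ) ^ k := by
  simpa using Finset.single_le_sum (f := fun k => (Nb : ℝ) ^ k) (fun k _ => by positivity)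
    (Finset.mem_range.2 (Nat.pos_of_ne_zero hn))

namespace CostMDP

variable {S A : Type*} [MeasurableSpace S] [MeasurableSpace A]

/-- The deviation `u` solves `3 * exp (-Nb α u² / 5) = δ / c`, with `c = ∑ Nb ^ k` from the union
bound. -/
theorem one_sub_le_measureReal_icvarQ_sub_le (M : CostMDP S A) (hγ₀ : 0 ≤ M.discount)
    (hγ₁ : M.discount ≤ 1) {Rmin Rmax : ℝ} (hR : Rmin ≤ Rmax)
    (hc : ∀ p, M.cost p ∈ Set.Icc Rmin Rmax) (π : Policy S A) {α : ℝ} (hα₀ : 0 < α)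
    (hα₁ : α ≤ 1) {Nb : ℕ} (hNb : 0 < Nb) {δ : ℝ} (hδ₀ : 0 < δ) (hδ₁ : δ < 1) {T t n : ℕ}
    (ht : t + n = T) {B : ℝ}
    (hB : M.discount * (Rmax - Rmin) *
      √(5 * Real.log (3 * (∑ k ∈ Finset.range n, (Nb : ℝ) ^ k) / δ) / (α * Nb)) *
        ∑ k ∈ Finset.range n, ((n : ℝ) - k) ≤ B) (s : S) (a : A) :
    1 - δ ≤ (M.estimateQ π α Nb T t s a).real {q | M.icvarQ π α T t s a - q ≤ B} := by
  set c := ∑ k ∈ Finset.range n, (Nb : ℝ) ^ k with hc_def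
  have hNb' : (0 : ℝ) < Nb := by exact_mod_cast hNb
  have hc₀ : 0 ≤ c := by positivity
  have h := M.measureReal_estimateQ_le hγ₀ hγ₁ hR hc π hα₀ hα₁ hNb (σ := 1) (.inl rfl)
    (u := √(5 * Real.log (3 * c / δ) / (α * Nb))) (d := δ / c) (Real.sqrt_nonneg _)
    (by positivity) n (fun hn ν _ Y x y hYm hY => by
      have hc₁ : 1 ≤ c := one_le_sum_pow hn
      have hlog : 0 ≤ Real.log (3 * c / δ) := Real.log_nonneg <| by
        rw [one_le_div hδ₀]; linarith
      have h1 := measureReal_pi_empCVaR_lt_cvar_sub_le (μ := ν) hNb hα₀ hα₁ hYm hY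
        (Real.sqrt_nonneg (5 * Real.log (3 * c / δ) / (α * Nb)))
      simp only [one_mul]
      refine h1.trans_eq ?_
      rw [Real.sq_sqrt (by positivity)]
      have h2 : -(Nb * (α * (5 * Real.log (3 * c / δ) / (α * Nb))) / 5) =
        -Real.log (3 * c / δ) := by field_simp
      rw [h2, Real.exp_neg, Real.exp_log (by positivity)]
      field_simp) t ht s a
  have hset : {q | M.icvarQ π α T t s a - q ≤ B} = {q | B < M.icvarQ π α T t s a - q}ᶜ := by
    ext q; simp
  rw [hset, probReal_compl_eq_one_sub (measurableSet_lt measurable_const (by fun_prop))]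
  refine sub_le_sub_left ((measureReal_mono fun q hq => ?_).trans (h.trans ?_)) 1
  · simp only [Set.mem_ofPred_eq, one_mul] at hq ⊢
    exact hB.trans_lt hq
  -- The sum `c` is zero when no level remains; then `δ / c` is `0` and so is the failure
  -- probability.
  · rcases hc₀.eq_or_lt with h0 | h0
    · simp [← h0, hδ₀.le]
    · rw [div_mul_cancel₀ _ h0.ne']

/-- Here `u` solves `exp (-2 Nb (α u)²) = δ / c`, whence its factor `1 / α`. -/
theorem one_sub_le_measureReal_neg_le_icvarQ_sub (M : CostMDP S A) (hγ₀ : 0 ≤ M.discount)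
    (hγ₁ : M.discount ≤ 1) {Rmin Rmax : ℝ} (hR : Rmin ≤ Rmax)
    (hc : ∀ p, M.cost p ∈ Set.Icc Rmin Rmax) (π : Policy S A) {α : ℝ} (hα₀ : 0 < α)
    (hα₁ : α ≤ 1) {Nb : ℕ} (hNb : 0 < Nb) {δ : ℝ} (hδ₀ : 0 < δ) (hδ₁ : δ < 1) {T t n : ℕ}
    (ht : t + n = T) {B : ℝ}
    (hB : M.discount * (Rmax - Rmin) *
      (1 / α * √(Real.log ((∑ k ∈ Finset.range n, (Nb : ℝ) ^ k) / δ) / (2 * Nb))) *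
        ∑ k ∈ Finset.range n, ((n : ℝ) - k) ≤ B) (s : S) (a : A) :
    1 - δ ≤ (M.estimateQ π α Nb T t s a).real {q | M.icvarQ π α T t s a - q ≥ -B} := by
  set c := ∑ k ∈ Finset.range n, (Nb : ℝ) ^ k with hc_def
  have hNb' : (0 : ℝ) < Nb := by exact_mod_cast hNb
  have hc₀ : 0 ≤ c := by positivity
  have h := M.measureReal_estimateQ_le hγ₀ hγ₁ hR hc π hα₀ hα₁ hNb (σ := -1) (.inr rfl)
    (u := 1 / α * √(Real.log (c / δ) / (2 * Nb))) (d := δ / c) (by positivity)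
    (by positivity) n (fun hn ν _ Y x y hYm hY => by
      have hc₁ : 1 ≤ c := one_le_sum_pow hn
      have hlog : 0 ≤ Real.log (c / δ) := Real.log_nonneg <| by
        rw [one_le_div hδ₀]; linarith
      have h1 := measureReal_pi_cvar_lt_empCVaR_sub_le (μ := ν) hNb hα₀ hα₁ hYm hY
        (by positivity : 0 ≤ 1 / α * √(Real.log (c / δ) / (2 * Nb)))
      simp only [neg_one_mul, neg_sub]
      refine h1.trans_eq ?_
      have h2 : α * (1 / α * √(Real.log (c / δ) / (2 * Nb))) =
        √(Real.log (c / δ) / (2 * Nb)) := by field_simp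
      rw [h2, Real.sq_sqrt (by positivity)]
      have h3 : -(2 * Nb * (Real.log (c / δ) / (2 * Nb))) = -Real.log (c / δ) := by field_simp
      rw [h3, Real.exp_neg, Real.exp_log (by positivity), inv_div]) t ht s a
  have hset : {q | M.icvarQ π α T t s a - q ≥ -B} =
      {q | B < -1 * (M.icvarQ π α T t s a - q)}ᶜ := by
    ext q
    simp only [Set.mem_ofPred_eq, Set.mem_compl_iff, not_lt, ge_iff_le]
    constructor <;> intro h <;> linarith
  rw [hset, probReal_compl_eq_one_sub (measurableSet_lt measurable_const (by fun_prop))]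
  refine sub_le_sub_left ((measureReal_mono fun q hq => ?_).trans (h.trans ?_)) 1
  · exact hB.trans_lt hq
  · rcases hc₀.eq_or_lt with h0 | h0
    · simp [← h0, hδ₀.le]
    · rw [div_mul_cancel₀ _ h0.ne']

end CostMDP

/-- Since `α ≤ 1`, dividing each nonnegative term by `α ^ k` can only increase it. -/
theorem sum_sub_le_horizonFactor {α : ℝ} (hα₀ : 0 < α) (hα₁ : α ≤ 1) {T t n : ℕ}
    (ht : t + n = T) : ∑ k ∈ Finset.range n, ((n : ℝ) - k) ≤ horizonFactor α T t := by
  have hn : T - t = n := by omega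
  have hn' : (T : ℝ) - t = n := by rw [← ht]; push_cast; ring
  rw [horizonFactor, hn, hn']
  refine Finset.sum_le_sum fun k hk => ?_
  have hk' : (k : ℝ) ≤ n := by exact_mod_cast (Finset.mem_range.1 hk).le
  exact le_div_self (by linarith) (by positivity) (pow_le_one₀ hα₀.le hα₁)

theorem horizonFactor_le_horizonFactor' {α : ℝ} (hα₀ : 0 < α) (T t : ℕ) :
    horizonFactor α T t ≤ horizonFactor' α T t := by
  refine Finset.sum_le_sum fun k _ => ?_
  gcongr
  linarith

theorem POMDP.beliefCost_mem_Icc {X A Z : Type*} [MeasurableSpace X] [MeasurableSpace A]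
    [MeasurableSpace Z] (M : POMDP X A Z) {Rmin Rmax : ℝ}
    (hc : ∀ x a, M.cost (x, a) ∈ Set.Icc Rmin Rmax) {N : ℕ} (p : ParticleBelief X N × A) :
    M.beliefCost N p ∈ Set.Icc Rmin Rmax := by
  obtain ⟨i, hi⟩ := p.1.2
  have hpos : 0 < ∑ i, ((p.1.1 i).2 : ℝ) :=
    Finset.sum_pos' (fun _ _ => NNReal.coe_nonneg _) ⟨i, Finset.mem_univ i, by exact_mod_cast hi⟩
  constructor
  · rw [beliefCost, le_div_iff₀ hpos, Finset.mul_sum]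
    refine Finset.sum_le_sum fun j _ => ?_
    rw [mul_comm]
    exact mul_le_mul_of_nonneg_left (hc _ _).1 (NNReal.coe_nonneg _)
  · rw [beliefCost, div_le_iff₀ hpos, Finset.mul_sum]
    refine Finset.sum_le_sum fun j _ => ?_
    rw [mul_comm Rmax]
    exact mul_le_mul_of_nonneg_left (hc _ _).2 (NNReal.coe_nonneg _)

theorem theorem1 {X A Z : Type*} [MeasurableSpace X] [MeasurableSpace A] [MeasurableSpace Z]
    (M : POMDP X A Z) (hγ₀ : 0 ≤ M.discount) (hγ₁ : M.discount ≤ 1)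
    (Rmin Rmax : ℝ) (hc : ∀ x a, M.cost (x, a) ∈ Set.Icc Rmin Rmax)
    (Np : ℕ) (hM : M.Nondegenerate Np)
    (π : Policy (ParticleBelief X Np) A)
    (α : ℝ) (hα₀ : 0 < α) (hα₁ : α ≤ 1) (δ : ℝ) (hδ₀ : 0 < δ) (hδ₁ : δ < 1)
    (T t : ℕ) (ht : t ≤ T) (Nb : ℕ) (b : ParticleBelief X Np) (a : A) :
    (1 < Nb →
      1 - δ ≤ ((M.particleBeliefMDP Np hM).estimateQ π α Nb T t b a).real
        {q | (M.particleBeliefMDP Np hM).icvarQ π α T t b a - q ≤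
          M.discount * (Rmax - Rmin) * horizonFactor α T t *
            √(5 * Real.log (3 * ((Nb : ℝ) ^ (T - t) - 1) / (δ * ((Nb : ℝ) - 1))) /
              (α * Nb))} ∧
      1 - δ ≤ ((M.particleBeliefMDP Np hM).estimateQ π α Nb T t b a).real
        {q | (M.particleBeliefMDP Np hM).icvarQ π α T t b a - q ≥
          -(M.discount * (Rmax - Rmin) / α *
            √(Real.log (((Nb : ℝ) ^ (T - t) - 1) / (δ * ((Nb : ℝ) - 1))) / (2 * Nb)) *
            horizonFactor' α T t)}) ∧
    (Nb = 1 →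
      1 - δ ≤ ((M.particleBeliefMDP Np hM).estimateQ π α Nb T t b a).real
        {q | (M.particleBeliefMDP Np hM).icvarQ π α T t b a - q ≤
          M.discount * (Rmax - Rmin) * √(5 * Real.log (3 * ((T : ℝ) - t) / δ) / α) *
            horizonFactor α T t} ∧
      1 - δ ≤ ((M.particleBeliefMDP Np hM).estimateQ π α Nb T t b a).real
        {q | (M.particleBeliefMDP Np hM).icvarQ π α T t b a - q ≥
          -(M.discount * (Rmax - Rmin) / α * √(Real.log (((T : ℝ) - t) / δ) / 2) *
            horizonFactor' α T t)}) := by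
  obtain ⟨n, rfl⟩ := Nat.exists_eq_add_of_le ht
  -- A particle belief contains a particle, so the cost takes a value in the interval.
  have hR : Rmin ≤ Rmax := by
    obtain ⟨i, -⟩ := b.2
    exact (hc (b.1 i).1 a).1.trans (hc (b.1 i).1 a).2
  have hγR : 0 ≤ M.discount * (Rmax - Rmin) := mul_nonneg hγ₀ (sub_nonneg.2 hR)
  have hF := sum_sub_le_horizonFactor hα₀ hα₁ (rfl : t + n = t + n)
  have hF' := hF.trans (horizonFactor_le_horizonFactor' hα₀ (t + n) t)
  have hcost := fun p => M.beliefCost_mem_Icc hc (N := Np) p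
  set P := M.particleBeliefMDP Np hM
  refine ⟨fun hNb => ⟨?_, ?_⟩, fun hNb => ⟨?_, ?_⟩⟩
  · have hNb₁ : (1 : ℝ) < Nb := by exact_mod_cast hNb
    refine P.one_sub_le_measureReal_icvarQ_sub_le hγ₀ hγ₁ hR hcost π hα₀ hα₁
      (by omega) hδ₀ hδ₁ rfl ?_ b a
    -- For `Nb > 1` the union-bound count is the geometric sum `(Nb ^ n - 1) / (Nb - 1)`; for `Nb =
    -- 1` it is `n`.
    rw [geom_sum_eq hNb₁.ne', Nat.add_sub_cancel_left, mul_right_comm _ (horizonFactor _ _ _),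
      ← mul_div_assoc, div_div, mul_comm ((Nb : ℝ) - 1)]
    exact mul_le_mul_of_nonneg_left hF (mul_nonneg hγR (Real.sqrt_nonneg _))
  · have hNb₁ : (1 : ℝ) < Nb := by exact_mod_cast hNb
    refine P.one_sub_le_measureReal_neg_le_icvarQ_sub hγ₀ hγ₁ hR hcost π hα₀ hα₁
      (by omega) hδ₀ hδ₁ rfl ?_ b a
    rw [geom_sum_eq hNb₁.ne', Nat.add_sub_cancel_left, div_div, mul_comm ((Nb : ℝ) - 1),
      ← mul_assoc, mul_one_div]
    exact mul_le_mul_of_nonneg_left hF'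
      (mul_nonneg (div_nonneg hγR hα₀.le) (Real.sqrt_nonneg _))
  · subst hNb
    refine P.one_sub_le_measureReal_icvarQ_sub_le hγ₀ hγ₁ hR hcost π hα₀ hα₁
      one_pos hδ₀ hδ₁ rfl ?_ b a
    simp only [Nat.cast_one, one_pow, Finset.sum_const, Finset.card_range, nsmul_eq_mul, mul_one,
      Nat.cast_add, add_sub_cancel_left]
    exact mul_le_mul_of_nonneg_left hF (mul_nonneg hγR (Real.sqrt_nonneg _))
  · subst hNb
    refine P.one_sub_le_measureReal_neg_le_icvarQ_sub hγ₀ hγ₁ hR hcost π hα₀ hα₁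
      one_pos hδ₀ hδ₁ rfl ?_ b a
    simp only [Nat.cast_one, one_pow, Finset.sum_const, Finset.card_range, nsmul_eq_mul, mul_one,
      Nat.cast_add, add_sub_cancel_left]
    rw [← mul_assoc, mul_one_div]
    exact mul_le_mul_of_nonneg_left hF'
      (mul_nonneg (div_nonneg hγR hα₀.le) (Real.sqrt_nonneg _))
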